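/- Gauss–Wantzel theorem. Let $n\ge 3$ be an integer. The regular $n$-gon is constructible with ruler and compass if and only if $$n = 2^k\, p_1\cdots p_s$$ for some integers $k\ge 0$ and $s\ge 0$ and some pairwise distinct Fermat primes $p_1,\dots,p_s$, that is, primes of the form $2^{2^r}+1$ with an integer $r\ge 0$. (For $s=0$ the product is empty and $n=2^k$.) Here "constructible" means that all the vertices of some regular $n$-gon in the plane can be obtained in finitely many steps, starting from the two endpoints of a given unit segment, where each step adds an intersection point of two distinct lines, of a line and a circle, or of two circles with different centres; each line is drawn through two distinct points already obtained, and each circle is drawn about a point already obtained with radius equal to the distance between two points already obtained. -/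

import Mathlib

/-- The Euclidean plane. -/
abbrev Plane : Type := EuclideanSpace ℝ (Fin 2)

/-- The points that can be constructed with ruler and compass, in finitely many steps, from the
endpoints `(0, 0)` and `(1, 0)` of a unit segment. A step adds an intersection point of two
different lines, of a line and a circle, or of two circles with different centres. Each line
passes through two different points already constructed; each circle has for its centre a point
already constructed and for its radius the distance of two points already constructed. -/
inductive ConstructiblePoint : Plane → Prop
  | origin : ConstructiblePoint !₂[0, 0]
  | unit : ConstructiblePoint !₂[1, 0]
  | line_line {A B C D P : Plane}
      (hA : ConstructiblePoint A) (hB : ConstructiblePoint B)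
      (hC : ConstructiblePoint C) (hD : ConstructiblePoint D)
      (hAB : A ≠ B) (hCD : C ≠ D) (hne : line[ℝ, A, B] ≠ line[ℝ, C, D])
      (h₁ : P ∈ line[ℝ, A, B]) (h₂ : P ∈ line[ℝ, C, D]) : ConstructiblePoint P
  | line_circle {A B C D E P : Plane}
      (hA : ConstructiblePoint A) (hB : ConstructiblePoint B)
      (hC : ConstructiblePoint C) (hD : ConstructiblePoint D) (hE : ConstructiblePoint E)
      (hAB : A ≠ B)
      (h₁ : P ∈ line[ℝ, A, B]) (h₂ : P ∈ Metric.sphere C (dist D E)) : ConstructiblePoint P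
  | circle_circle {A B C A' B' C' P : Plane}
      (hA : ConstructiblePoint A) (hB : ConstructiblePoint B) (hC : ConstructiblePoint C)
      (hA' : ConstructiblePoint A') (hB' : ConstructiblePoint B') (hC' : ConstructiblePoint C')
      (hne : A ≠ A')
      (h₁ : P ∈ Metric.sphere A (dist B C)) (h₂ : P ∈ Metric.sphere A' (dist B' C')) :
      ConstructiblePoint P

/-- A polygon with `n` vertices in the plane is regular if its vertices, in their order, are
equally spaced around a circle of positive radius `r`: the vertex with index `i` is seen from the
centre `O` in the direction `θ + 2 π i / n`. -/
def Polygon.IsRegular {n : ℕ} (poly : Polygon Plane n) : Prop :=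
  ∃ (O : Plane) (r θ : ℝ), 0 < r ∧ ∀ i : Fin n,
    poly i = O + r • !₂[Real.cos (θ + 2 * Real.pi * (i : ℕ) / n),
                        Real.sin (θ + 2 * Real.pi * (i : ℕ) / n)]

/-- The regular `n`-gon is constructible with ruler and compass: one can construct all the
vertices of some regular polygon with `n` vertices. -/
def RegularPolygonConstructible (n : ℕ) : Prop :=
  ∃ poly : Polygon Plane n, poly.IsRegular ∧ ∀ i : Fin n, ConstructiblePoint (poly i)

/-! Both sides are equivalent to φ(n) being a power of 2; the arithmetic half is
`Nat.exists_totient_eq_two_pow_iff`. Let ζ = exp(2πi/n), of degree φ(n) over ℚ.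

Necessity: the coordinates of constructible points lie in every subfield of ℝ closed under square
roots (`ConstructiblePoint.coord_mem`), in particular in the real part of `quadraticClosure`. Since
ζ is a ratio of differences of vertices, it lies in a tower of quadratic extensions, so φ(n) divides
a power of 2.

Sufficiency: the constructible points form a subfield of ℂ closed under square roots. Any such field
F contains ζ when φ(n) is a power of 2 (`IsPrimitiveRoot.mem_subfield_of_totient_eq_two_pow`):
otherwise the Galois group of F(ζ)/F is a nontrivial 2-group, and a subgroup of index 2 yields a
square root missing from F. -/

/-! ### Integers whose totient is a power of 2 -/

theorem Nat.prime_eq_fermat_of_totient {n p j : ℕ} (hp : p.Prime) (hp2 : p ≠ 2) (hpn : p ∣ n)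
    (h : n.totient = 2 ^ j) : ∃ r : ℕ, p = 2 ^ (2 ^ r) + 1 := by
  have hd : p - 1 ∣ 2 ^ j := by
    rw [← h, ← Nat.totient_prime hp]
    exact Nat.totient_dvd_of_dvd hpn
  obtain ⟨i, -, hi⟩ := (Nat.dvd_prime_pow Nat.prime_two).1 hd
  have hpi : p = 2 ^ i + 1 := by have := hp.one_lt; lia
  have hi0 : i ≠ 0 := by
    rintro rfl
    exact hp2 hpi
  obtain ⟨r, rfl⟩ := Nat.pow_of_pow_add_prime one_lt_two hi0 (hpi ▸ hp)
  exact ⟨r, hpi⟩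

theorem Nat.exists_totient_eq_two_pow_iff {n : ℕ} (hn : n ≠ 0) :
    (∃ j, n.totient = 2 ^ j) ↔ ∃ (k : ℕ) (S : Finset ℕ),
      (∀ p ∈ S, p.Prime ∧ ∃ r : ℕ, p = 2 ^ (2 ^ r) + 1) ∧ n = 2 ^ k * ∏ p ∈ S, p := by
  constructor
  · rintro ⟨j, hj⟩
    obtain ⟨k, m, hm, rfl⟩ := Nat.exists_eq_two_pow_mul_odd hn
    have hm2 {p : ℕ} (hp : p ∣ m) : p ≠ 2 := by
      rintro rfl
      exact Nat.not_even_iff_odd.2 hm (even_iff_two_dvd.2 hp)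
    -- If p² divides m, then φ(p²) = p φ(p) divides φ(n), a power of 2, which forces p = 2.
    have hsq : Squarefree m := by
      rw [Nat.squarefree_iff_prime_squarefree]
      intro p hp hpm
      have hd : p ∣ 2 ^ j := by
        rw [← hj]
        refine dvd_trans ?_ (Nat.totient_dvd_of_dvd (hpm.mul_left (2 ^ k)))
        rw [Nat.totient_mul_of_prime_of_dvd hp dvd_rfl]
        exact dvd_mul_right _ _
      exact hm2 (dvd_of_mul_left_dvd hpm)
        ((Nat.prime_dvd_prime_iff_eq hp Nat.prime_two).1 (hp.dvd_of_dvd_pow hd))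
    refine ⟨k, m.primeFactors, fun p hp ↦ ?_, by rw [Nat.prod_primeFactors_of_squarefree hsq]⟩
    have hpm := Nat.dvd_of_mem_primeFactors hp
    have hp := Nat.prime_of_mem_primeFactors hp
    exact ⟨hp, Nat.prime_eq_fermat_of_totient hp (hm2 hpm) (hpm.mul_left _) hj⟩
  · rintro ⟨k, S, hS, rfl⟩
    have hodd {p : ℕ} (hp : p ∈ S) : p ≠ 2 := by
      obtain ⟨-, r, rfl⟩ := hS p hp
      have := Nat.two_lt_fermatNumber r
      exact this.ne'
    have hcop : Nat.Coprime (2 ^ k) (∏ p ∈ S, p) :=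
      Nat.Coprime.prod_right fun p hp ↦ Nat.Coprime.pow_left k <|
        (Nat.coprime_primes Nat.prime_two (hS p hp).1).2 (hodd hp).symm
    have hprod : ∃ j, (∏ p ∈ S, p).totient = 2 ^ j := by
      clear hn hcop hodd
      induction S using Finset.induction_on with
      | empty => exact ⟨0, by simp⟩
      | insert p T hp ih =>
        obtain ⟨j, hj⟩ := ih fun q hq ↦ hS q (Finset.mem_insert_of_mem hq)
        obtain ⟨hpp, r, hr⟩ := hS p (Finset.mem_insert_self p T)
        have hc : Nat.Coprime p (∏ q ∈ T, q) := Nat.Coprime.prod_right fun q hq ↦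
          (Nat.coprime_primes hpp (hS q (Finset.mem_insert_of_mem hq)).1).2 fun h ↦ hp (h ▸ hq)
        refine ⟨2 ^ r + j, ?_⟩
        rw [Finset.prod_insert hp, Nat.totient_mul hc, hj, Nat.totient_prime hpp, pow_add, hr,
          Nat.add_sub_cancel]
    have hpow : ∃ j, (2 ^ k).totient = 2 ^ j := by
      rcases k with _ | k
      · exact ⟨0, by simp⟩
      · exact ⟨k, by simp [Nat.totient_prime_pow_succ Nat.prime_two]⟩
    obtain ⟨a, ha⟩ := hpow
    obtain ⟨b, hb⟩ := hprod
    exact ⟨a + b, by rw [Nat.totient_mul hcop, ha, hb, pow_add]⟩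

/-! ### Lines, circles and construction steps in coordinates -/

theorem Plane.mem_line_iff {A B P : Plane} (hAB : A ≠ B) :
    P ∈ line[ℝ, A, B] ↔ (P 0 - A 0) * (B 1 - A 1) = (P 1 - A 1) * (B 0 - A 0) := by
  rw [mem_affineSpan_pair_iff_exists_lineMap_eq]
  constructor
  · rintro ⟨t, rfl⟩
    simp [AffineMap.lineMap_apply]
    ring
  · intro h
    by_cases h0 : B 0 - A 0 = 0
    · have h1 : B 1 - A 1 ≠ 0 := fun h1 ↦ hAB <| by
        ext i
        fin_cases i
        · exact (sub_eq_zero.1 h0).symm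
        · exact (sub_eq_zero.1 h1).symm
      refine ⟨(P 1 - A 1) / (B 1 - A 1), ?_⟩
      have h2 : P 0 - A 0 = 0 := by simpa [h0, h1] using h
      ext i
      fin_cases i
      · simp [AffineMap.lineMap_apply, h0]; linarith
      · simp [AffineMap.lineMap_apply, h1]
    · refine ⟨(P 0 - A 0) / (B 0 - A 0), ?_⟩
      ext i
      fin_cases i
      · simp [AffineMap.lineMap_apply, h0]
      · simp only [AffineMap.lineMap_apply, Fin.mk_one, vsub_eq_sub, vadd_eq_add, PiLp.add_apply,
          PiLp.smul_apply, PiLp.sub_apply, smul_eq_mul]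
        field_simp
        linarith

theorem Plane.dist_sq (A B : Plane) : dist A B ^ 2 = (A 0 - B 0) ^ 2 + (A 1 - B 1) ^ 2 := by
  rw [EuclideanSpace.dist_eq, Real.sq_sqrt (by positivity)]
  simp [Fin.sum_univ_two, Real.dist_eq, sq_abs]

theorem Plane.mem_sphere_iff {P C D E : Plane} :
    P ∈ Metric.sphere C (dist D E) ↔
      (P 0 - C 0) ^ 2 + (P 1 - C 1) ^ 2 = (D 0 - E 0) ^ 2 + (D 1 - E 1) ^ 2 := by
  rw [Metric.mem_sphere, ← Plane.dist_sq, ← Plane.dist_sq,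
    pow_left_inj₀ dist_nonneg dist_nonneg two_ne_zero]

theorem Plane.mk_ne {a b c d : ℝ} (h : a ≠ c ∨ b ≠ d) : (!₂[a, b] : Plane) ≠ !₂[c, d] := by
  intro he
  have h0 : a = c := by simpa using congrArg (fun P : Plane ↦ P 0) he
  have h1 : b = d := by simpa using congrArg (fun P : Plane ↦ P 1) he
  tauto

namespace ConstructiblePoint

/-- The determinant condition supplies all three distinctness hypotheses of `line_line`. -/
theorem of_lines {a₀ a₁ b₀ b₁ c₀ c₁ d₀ d₁ x y : ℝ}
    (hA : ConstructiblePoint !₂[a₀, a₁]) (hB : ConstructiblePoint !₂[b₀, b₁])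
    (hC : ConstructiblePoint !₂[c₀, c₁]) (hD : ConstructiblePoint !₂[d₀, d₁])
    (hdet : (b₀ - a₀) * (d₁ - c₁) ≠ (b₁ - a₁) * (d₀ - c₀))
    (h₁ : (x - a₀) * (b₁ - a₁) = (y - a₁) * (b₀ - a₀))
    (h₂ : (x - c₀) * (d₁ - c₁) = (y - c₁) * (d₀ - c₀)) : ConstructiblePoint !₂[x, y] := by
  have hAB : (!₂[a₀, a₁] : Plane) ≠ !₂[b₀, b₁] := Plane.mk_ne <| by
    by_contra! h
    apply hdet
    rw [h.1, h.2]
    ring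
  have hCD : (!₂[c₀, c₁] : Plane) ≠ !₂[d₀, d₁] := Plane.mk_ne <| by
    by_contra! h
    apply hdet
    rw [h.1, h.2]
    ring
  refine line_line hA hB hC hD hAB hCD ?_ ((Plane.mem_line_iff hAB).2 (by simpa using h₁))
    ((Plane.mem_line_iff hCD).2 (by simpa using h₂))
  intro he
  have hA' := (Plane.mem_line_iff hCD).1 (he ▸ left_mem_affineSpan_pair ℝ _ _)
  have hB' := (Plane.mem_line_iff hCD).1 (he ▸ right_mem_affineSpan_pair ℝ _ _)
  simp at hA' hB'
  apply hdet
  linear_combination hB' - hA'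

theorem of_line_circle {a₀ a₁ b₀ b₁ c₀ c₁ d₀ d₁ e₀ e₁ x y : ℝ}
    (hA : ConstructiblePoint !₂[a₀, a₁]) (hB : ConstructiblePoint !₂[b₀, b₁])
    (hC : ConstructiblePoint !₂[c₀, c₁]) (hD : ConstructiblePoint !₂[d₀, d₁])
    (hE : ConstructiblePoint !₂[e₀, e₁]) (hAB : a₀ ≠ b₀ ∨ a₁ ≠ b₁)
    (h₁ : (x - a₀) * (b₁ - a₁) = (y - a₁) * (b₀ - a₀))
    (h₂ : (x - c₀) ^ 2 + (y - c₁) ^ 2 = (d₀ - e₀) ^ 2 + (d₁ - e₁) ^ 2) :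
    ConstructiblePoint !₂[x, y] :=
  line_circle hA hB hC hD hE (Plane.mk_ne hAB)
    ((Plane.mem_line_iff (Plane.mk_ne hAB)).2 (by simpa using h₁))
    (Plane.mem_sphere_iff.2 (by simpa using h₂))

theorem of_circles {a₀ a₁ b₀ b₁ c₀ c₁ a₀' a₁' b₀' b₁' c₀' c₁' x y : ℝ}
    (hA : ConstructiblePoint !₂[a₀, a₁]) (hB : ConstructiblePoint !₂[b₀, b₁])
    (hC : ConstructiblePoint !₂[c₀, c₁]) (hA' : ConstructiblePoint !₂[a₀', a₁'])
    (hB' : ConstructiblePoint !₂[b₀', b₁']) (hC' : ConstructiblePoint !₂[c₀', c₁'])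
    (hne : a₀ ≠ a₀' ∨ a₁ ≠ a₁')
    (h₁ : (x - a₀) ^ 2 + (y - a₁) ^ 2 = (b₀ - c₀) ^ 2 + (b₁ - c₁) ^ 2)
    (h₂ : (x - a₀') ^ 2 + (y - a₁') ^ 2 = (b₀' - c₀') ^ 2 + (b₁' - c₁') ^ 2) :
    ConstructiblePoint !₂[x, y] :=
  circle_circle hA hB hC hA' hB' hC' (Plane.mk_ne hne)
    (Plane.mem_sphere_iff.2 (by simpa using h₁)) (Plane.mem_sphere_iff.2 (by simpa using h₂))

end ConstructiblePoint

/-! ### The field of constructible numbers and its square roots -/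

/-- A real number is constructible if the corresponding point of the first axis is. -/
def ConstructibleReal (x : ℝ) : Prop := ConstructiblePoint !₂[x, 0]

namespace ConstructibleReal

open ConstructiblePoint

theorem zero : ConstructibleReal 0 := origin

theorem one : ConstructibleReal 1 := unit

theorem add {a b : ℝ} (ha : ConstructibleReal a) (hb : ConstructibleReal b) :
    ConstructibleReal (a + b) :=
  of_line_circle origin unit ha hb origin (by simp) (by ring) (by ring)

theorem neg {a : ℝ} (ha : ConstructibleReal a) : ConstructibleReal (-a) :=
  of_line_circle origin unit origin ha origin (by simp) (by ring) (by ring)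

theorem sub {a b : ℝ} (ha : ConstructibleReal a) (hb : ConstructibleReal b) :
    ConstructibleReal (a - b) := by
  rw [sub_eq_add_neg]
  exact ha.add hb.neg

/-- Apex of the equilateral triangle on the segment from -1 to 1; with the origin it determines the
second axis. -/
theorem second_axis_point : ConstructiblePoint !₂[0, √3] := by
  have h3 : (√3) ^ 2 = (3 : ℝ) := Real.sq_sqrt (by norm_num)
  exact of_circles one one one.neg one.neg one one.neg (by norm_num)
    (by linear_combination h3) (by linear_combination h3)

theorem second_axis {y : ℝ} (hy : ConstructibleReal y) : ConstructiblePoint !₂[0, y] :=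
  of_line_circle origin second_axis_point origin hy origin
    (.inr (Real.sqrt_pos.2 three_pos).ne) (by ring) (by ring)

theorem mk {x y : ℝ} (hx : ConstructibleReal x) (hy : ConstructibleReal y) :
    ConstructiblePoint !₂[x, y] := by
  by_cases h : x = 0
  · subst h
    exact hy.second_axis
  -- Circles about (x, 0) of radius |y| and about (0, y) of radius |x|; their centres differ because
  -- x ≠ 0.
  · exact of_circles hx hy origin hy.second_axis hx origin (by simp [h]) (by ring) (by ring)

theorem of_point {x y : ℝ} (h : ConstructiblePoint !₂[x, y]) :
    ConstructibleReal x ∧ ConstructibleReal y := by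
  by_cases hy : y = 0
  · subst hy
    exact ⟨h, zero⟩
  -- The mirror image lies on the circles about 0 and 1 through the point; joining the two gives a
  -- perpendicular to the first axis.
  have h' : ConstructiblePoint !₂[x, -y] :=
    of_circles origin h origin unit h unit (by simp) (by ring) (by ring)
  have hx : ConstructibleReal x := by
    refine of_lines origin unit h h' ?_ (by ring) (by ring)
    intro he
    exact hy (by linarith)
  exact ⟨hx, of_line_circle origin unit origin h hx (by simp) (by ring) (by ring)⟩

/-- Similar triangles: the line through the origin and (1, b) meets the vertical at a in (a, ab).
The inverse uses the line through (a, 1) and the vertical at 1. -/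
theorem mul {a b : ℝ} (ha : ConstructibleReal a) (hb : ConstructibleReal b) :
    ConstructibleReal (a * b) :=
  (of_point (x := a) <| of_lines origin (one.mk hb) ha (ha.mk one) (by simp) (by ring)
    (by ring)).2

theorem inv {a : ℝ} (ha : ConstructibleReal a) : ConstructibleReal a⁻¹ := by
  by_cases h : a = 0
  · simpa [h] using zero
  · exact (of_point (x := 1) <| of_lines origin (ha.mk one) one (one.mk one) (by simpa using h)
      (by field_simp; ring) (by ring)).2

/-- Geometric mean: the circle with diameter from -1 to a meets the second axis at height √a. -/
theorem sqrt {a : ℝ} (ha : ConstructibleReal a) : ConstructibleReal (√a) := by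
  by_cases h : 0 ≤ a
  · have hc : ConstructibleReal ((a - 1) * (1 + 1)⁻¹) := (ha.sub one).mul (one.add one).inv
    have hs := Real.sq_sqrt h
    exact (of_point (x := 0) <| of_line_circle origin second_axis_point hc hc one.neg
      (.inr (Real.sqrt_pos.2 three_pos).ne)
      (by ring) (by linear_combination hs)).2
  · rw [Real.sqrt_eq_zero_of_nonpos (by linarith)]
    exact zero

end ConstructibleReal

/-- The complex numbers that represent constructible points. -/
def constructibleField : Subfield ℂ where
  carrier := {z | ConstructibleReal z.re ∧ ConstructibleReal z.im}
  zero_mem' := ⟨.zero, .zero⟩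
  one_mem' := ⟨.one, .zero⟩
  add_mem' ha hb := ⟨ha.1.add hb.1, ha.2.add hb.2⟩
  neg_mem' ha := ⟨ha.1.neg, ha.2.neg⟩
  mul_mem' {a b} ha hb := by
    simp only [Set.mem_ofPred_eq, Complex.mul_re, Complex.mul_im]
    exact ⟨(ha.1.mul hb.1).sub (ha.2.mul hb.2), (ha.1.mul hb.2).add (ha.2.mul hb.1)⟩
  inv_mem' z hz := by
    have hn : ConstructibleReal (Complex.normSq z)⁻¹ := by
      rw [Complex.normSq_apply]
      exact ((hz.1.mul hz.1).add (hz.2.mul hz.2)).inv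
    simp only [Set.mem_ofPred_eq, Complex.inv_re, Complex.inv_im, div_eq_mul_inv]
    exact ⟨hz.1.mul hn, hz.2.neg.mul hn⟩

theorem mem_constructibleField {z : ℂ} :
    z ∈ constructibleField ↔ ConstructibleReal z.re ∧ ConstructibleReal z.im := Iff.rfl

/-- For z = x + iy, |z|² is the real square root of |z²|², and x², y² = (|z|² ± Re z²)/2. -/
theorem mem_constructibleField_of_sq_mem {z : ℂ} (hz : z ^ 2 ∈ constructibleField) :
    z ∈ constructibleField := by
  obtain ⟨h₁, h₂⟩ := mem_constructibleField.1 hz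
  rw [pow_two, Complex.mul_re] at h₁
  rw [pow_two, Complex.mul_im] at h₂
  set x := z.re
  set y := z.im
  have h2 : ConstructibleReal 2⁻¹ := by
    rw [← one_add_one_eq_two]
    exact (ConstructibleReal.one.add .one).inv
  have hn : ConstructibleReal (x ^ 2 + y ^ 2) := by
    have := ((h₁.mul h₁).add (h₂.mul h₂)).sqrt
    rwa [show (x * x - y * y) * (x * x - y * y) + (x * y + y * x) * (x * y + y * x)
      = (x ^ 2 + y ^ 2) ^ 2 by ring, Real.sqrt_sq (by positivity)] at this
  have of_abs {t : ℝ} (h : ConstructibleReal (t ^ 2)) : ConstructibleReal t := by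
    have := h.sqrt
    rw [Real.sqrt_sq_eq_abs] at this
    rcases abs_choice t with ht | ht
    · rwa [ht] at this
    · rw [ht] at this
      simpa using this.neg
  refine ⟨of_abs ?_, of_abs ?_⟩
  · convert (hn.add h₁).mul h2 using 1
    ring
  · convert (hn.sub h₁).mul h2 using 1
    ring

/-! ### Constructible coordinates lie in every real field closed under square roots -/

namespace Subfield

variable {F : Subfield ℝ}

theorem mem_of_linear_equations {a b c a' b' c' x y : ℝ} (ha : a ∈ F) (hb : b ∈ F) (hc : c ∈ F)
    (ha' : a' ∈ F) (hb' : b' ∈ F) (hc' : c' ∈ F) (hdet : a * b' - a' * b ≠ 0)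
    (h : a * x + b * y = c) (h' : a' * x + b' * y = c') : x ∈ F ∧ y ∈ F := by
  have hx : x = (c * b' - c' * b) / (a * b' - a' * b) := by
    rw [eq_div_iff hdet, ← h, ← h']
    ring
  have hy : y = (a * c' - a' * c) / (a * b' - a' * b) := by
    rw [eq_div_iff hdet, ← h, ← h']
    ring
  have hd := sub_mem (mul_mem ha hb') (mul_mem ha' hb)
  rw [hx, hy]
  exact ⟨div_mem (sub_mem (mul_mem hc hb') (mul_mem hc' hb)) hd,
    div_mem (sub_mem (mul_mem ha hc') (mul_mem ha' hc)) hd⟩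

theorem mem_of_linear_of_circle (hF : ∀ z, z ^ 2 ∈ F → z ∈ F) {a b c p q s x y : ℝ} (ha : a ∈ F)
    (hb : b ∈ F) (hc : c ∈ F) (hp : p ∈ F) (hq : q ∈ F) (hs : s ∈ F) (hab : a ≠ 0 ∨ b ≠ 0)
    (h : a * x + b * y = c) (h' : (x - p) ^ 2 + (y - q) ^ 2 = s) : x ∈ F ∧ y ∈ F := by
  -- Lagrange's identity gives the square of this second linear form; together the two forms have
  -- determinant -(a² + b²) ≠ 0.
  have hw : b * (x - p) - a * (y - q) ∈ F := by
    refine hF _ ?_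
    rw [show (b * (x - p) - a * (y - q)) ^ 2
      = (a ^ 2 + b ^ 2) * s - (c - (a * p + b * q)) ^ 2 by rw [← h, ← h']; ring]
    exact sub_mem (mul_mem (add_mem (pow_mem ha 2) (pow_mem hb 2)) hs)
      (pow_mem (sub_mem hc (add_mem (mul_mem ha hp) (mul_mem hb hq))) 2)
  have hdet : a * -a - b * b ≠ 0 := by
    have : 0 < a ^ 2 + b ^ 2 := by
      rcases hab with h | h <;> positivity
    nlinarith
  refine mem_of_linear_equations ha hb hc hb (neg_mem ha)
    (add_mem hw (sub_mem (mul_mem hb hp) (mul_mem ha hq))) hdet h (by ring)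

end Subfield

theorem Plane.exists_coord_ne {A B : Plane} (h : A ≠ B) : B 1 - A 1 ≠ 0 ∨ A 0 - B 0 ≠ 0 := by
  by_contra! h0
  refine h ?_
  ext i
  fin_cases i
  · exact sub_eq_zero.1 h0.2
  · exact (sub_eq_zero.1 h0.1).symm

theorem ConstructiblePoint.coord_mem {F : Subfield ℝ} (hF : ∀ z, z ^ 2 ∈ F → z ∈ F) {P : Plane}
    (hP : ConstructiblePoint P) : P 0 ∈ F ∧ P 1 ∈ F := by
  have sq {D E : Plane} (hD : D 0 ∈ F ∧ D 1 ∈ F) (hE : E 0 ∈ F ∧ E 1 ∈ F) :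
      (D 0 - E 0) ^ 2 + (D 1 - E 1) ^ 2 ∈ F :=
    add_mem (pow_mem (sub_mem hD.1 hE.1) 2) (pow_mem (sub_mem hD.2 hE.2) 2)
  have cross {A B : Plane} (hA : A 0 ∈ F ∧ A 1 ∈ F) (hB : B 0 ∈ F ∧ B 1 ∈ F) :
      A 0 * (B 1 - A 1) + A 1 * (A 0 - B 0) ∈ F :=
    add_mem (mul_mem hA.1 (sub_mem hB.2 hA.2)) (mul_mem hA.2 (sub_mem hA.1 hB.1))
  induction hP with
  | origin => simp [zero_mem]
  | unit => simp [zero_mem, one_mem]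
  | @line_line A B C D P _ _ _ _ hAB hCD hne h₁ h₂ hA hB hC hD =>
    have hP₁ := (Plane.mem_line_iff hAB).1 h₁
    have hP₂ := (Plane.mem_line_iff hCD).1 h₂
    refine Subfield.mem_of_linear_equations (sub_mem hB.2 hA.2) (sub_mem hA.1 hB.1) (cross hA hB)
      (sub_mem hD.2 hC.2) (sub_mem hC.1 hD.1) (cross hC hD) ?_ (by linear_combination hP₁)
      (by linear_combination hP₂)
    -- Parallel lines through the common point P would coincide.
    intro hdet
    apply hne
    ext Q
    rw [Plane.mem_line_iff hAB, Plane.mem_line_iff hCD]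
    have hAB' := Plane.exists_coord_ne hAB
    have hCD' := Plane.exists_coord_ne hCD
    have key {u v u' v' q r : ℝ} (huv : u ≠ 0 ∨ v ≠ 0) (hd : u * v' - u' * v = 0)
        (h : u * q + v * r = 0) : u' * q + v' * r = 0 := by
      rcases huv with hu | hv
      · refine (mul_eq_zero.1 ?_).resolve_left hu
        linear_combination u' * h + r * hd
      · refine (mul_eq_zero.1 ?_).resolve_left hv
        linear_combination v' * h - q * hd
    constructor <;> intro hQ
    · linear_combination hP₂ + key (q := Q 0 - P 0) (r := Q 1 - P 1) hAB' hdet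
        (by linear_combination hQ - hP₁)
    · linear_combination hP₁ + key (q := Q 0 - P 0) (r := Q 1 - P 1) hCD'
        (u' := B 1 - A 1) (v' := A 0 - B 0) (by linear_combination -hdet)
        (by linear_combination hQ - hP₂)
  | @line_circle A B C D E P _ _ _ _ _ hAB h₁ h₂ hA hB hC hD hE =>
    have hP₁ := (Plane.mem_line_iff hAB).1 h₁
    exact Subfield.mem_of_linear_of_circle hF (sub_mem hB.2 hA.2) (sub_mem hA.1 hB.1)
      (cross hA hB) hC.1 hC.2 (sq hD hE) (Plane.exists_coord_ne hAB)
      (by linear_combination hP₁) (Plane.mem_sphere_iff.1 h₂)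
  | @circle_circle A B C A' B' C' P _ _ _ _ _ _ hne h₁ h₂ hA hB hC hA' hB' hC' =>
    have hP₁ := Plane.mem_sphere_iff.1 h₁
    have hP₂ := Plane.mem_sphere_iff.1 h₂
    have h2 : (2 : ℝ) ∈ F := ofNat_mem F 2
    -- Subtracting the circle equations replaces one circle by the radical axis.
    refine Subfield.mem_of_linear_of_circle hF (a := 2 * (A' 0 - A 0)) (b := 2 * (A' 1 - A 1))
      (mul_mem h2 (sub_mem hA'.1 hA.1)) (mul_mem h2 (sub_mem hA'.2 hA.2))
      (sub_mem (add_mem (sub_mem (sq hB hC) (sq hB' hC'))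
        (add_mem (pow_mem hA'.1 2) (pow_mem hA'.2 2))) (add_mem (pow_mem hA.1 2) (pow_mem hA.2 2)))
      hA.1 hA.2 (sq hB hC) ?_ (by linear_combination hP₁ - hP₂) hP₁
    have := Plane.exists_coord_ne hne
    rcases this with h | h
    · exact .inr (mul_ne_zero two_ne_zero h)
    · exact .inl (mul_ne_zero two_ne_zero (sub_ne_zero.2 (sub_ne_zero.1 h).symm))

/-! ### Towers of quadratic extensions of ℚ -/

open IntermediateField in
/-- Complex numbers obtained from `ℚ` by successive quadratic extensions. -/
inductive IsQuadraticTower : IntermediateField ℚ ℂ → Prop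
  | bot : IsQuadraticTower ⊥
  | step {K : IntermediateField ℚ ℂ} (hK : IsQuadraticTower K) {z : ℂ} (hz : z ^ 2 ∈ K) :
      IsQuadraticTower (K⟮z⟯.restrictScalars ℚ)

namespace IsQuadraticTower

open IntermediateField Polynomial

/-- Adjoin to K the square roots that build L, one by one. This directedness makes the union of all
towers a field. -/
theorem exists_le {K L : IntermediateField ℚ ℂ} (hK : IsQuadraticTower K)
    (hL : IsQuadraticTower L) : ∃ M, IsQuadraticTower M ∧ K ≤ M ∧ L ≤ M := by
  induction hL with
  | bot => exact ⟨K, hK, le_rfl, bot_le⟩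
  | @step L hL z hz ih =>
    obtain ⟨M, hM, hKM, hLM⟩ := ih
    have hMz : M ≤ M⟮z⟯.restrictScalars ℚ := fun x hx ↦ M⟮z⟯.algebraMap_mem ⟨x, hx⟩
    refine ⟨_, hM.step (hLM hz), hKM.trans hMz, ?_⟩
    refine (restrictScalars_adjoin ℚ L {z}).trans_le ?_
    rw [adjoin_le_iff, Set.union_subset_iff]
    refine ⟨fun x hx ↦ hMz (hLM hx), ?_⟩
    rw [Set.singleton_subset_iff]
    exact mem_adjoin_simple_self M z

theorem finrank_eq {K : IntermediateField ℚ ℂ} (hK : IsQuadraticTower K) :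
    ∃ m, Module.finrank ℚ K = 2 ^ m := by
  induction hK with
  | bot => exact ⟨0, by simp⟩
  | @step K hK z hz ih =>
    obtain ⟨m, hm⟩ := ih
    have hmonic : (X ^ 2 - C (⟨z ^ 2, hz⟩ : K)).Monic := monic_X_pow_sub_C _ two_ne_zero
    have hroot : aeval z (X ^ 2 - C (⟨z ^ 2, hz⟩ : K)) = 0 := by simp
    have hint : IsIntegral K z := ⟨_, hmonic, hroot⟩
    have hle : Module.finrank K K⟮z⟯ ≤ 2 := by
      rw [adjoin.finrank hint, ← natDegree_X_pow_sub_C (n := 2) (r := (⟨z ^ 2, hz⟩ : K))]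
      exact natDegree_le_natDegree (minpoly.min K z hmonic hroot)
    have hpos : 0 < Module.finrank K K⟮z⟯ := by
      rw [adjoin.finrank hint]
      exact minpoly.natDegree_pos hint
    have hmul : Module.finrank ℚ (K⟮z⟯.restrictScalars ℚ)
        = Module.finrank ℚ K * Module.finrank K K⟮z⟯ :=
      (Module.finrank_mul_finrank ℚ K K⟮z⟯).symm
    -- Degree 1 occurs when `z` already lies in `K`.
    obtain h | h : Module.finrank K K⟮z⟯ = 1 ∨ Module.finrank K K⟮z⟯ = 2 := by lia
    · exact ⟨m, by rw [hmul, hm, h, mul_one]⟩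
    · exact ⟨m + 1, by rw [hmul, hm, h, pow_succ]⟩

end IsQuadraticTower

/-- The smallest subfield of `ℂ` that is closed under square roots. -/
def quadraticClosure : Subfield ℂ where
  carrier := {z | ∃ K, IsQuadraticTower K ∧ z ∈ K}
  zero_mem' := ⟨⊥, .bot, zero_mem _⟩
  one_mem' := ⟨⊥, .bot, one_mem _⟩
  add_mem' := by
    rintro a b ⟨K, hK, ha⟩ ⟨L, hL, hb⟩
    obtain ⟨M, hM, hKM, hLM⟩ := hK.exists_le hL
    exact ⟨M, hM, add_mem (hKM ha) (hLM hb)⟩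
  mul_mem' := by
    rintro a b ⟨K, hK, ha⟩ ⟨L, hL, hb⟩
    obtain ⟨M, hM, hKM, hLM⟩ := hK.exists_le hL
    exact ⟨M, hM, mul_mem (hKM ha) (hLM hb)⟩
  neg_mem' := by
    rintro a ⟨K, hK, ha⟩
    exact ⟨K, hK, neg_mem ha⟩
  inv_mem' := by
    rintro a ⟨K, hK, ha⟩
    exact ⟨K, hK, inv_mem ha⟩

theorem mem_quadraticClosure_of_sq_mem {z : ℂ} (hz : z ^ 2 ∈ quadraticClosure) :
    z ∈ quadraticClosure := by
  obtain ⟨K, hK, h⟩ := hz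
  exact ⟨_, hK.step h, IntermediateField.mem_adjoin_simple_self K z⟩

theorem exists_totient_eq_two_pow_of_mem_quadraticClosure {n : ℕ} (hn : 0 < n) {ζ : ℂ}
    (hζ : IsPrimitiveRoot ζ n) (h : ζ ∈ quadraticClosure) : ∃ j, n.totient = 2 ^ j := by
  obtain ⟨K, hK, hmem⟩ := h
  obtain ⟨m, hm⟩ := hK.finrank_eq
  have : FiniteDimensional ℚ K := FiniteDimensional.of_finrank_pos (by rw [hm]; positivity)
  have hd : n.totient ∣ 2 ^ m := by
    rw [← Polynomial.natDegree_cyclotomic n ℚ, Polynomial.cyclotomic_eq_minpoly_rat hζ hn, ← hm,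
      ← IntermediateField.minpoly_eq (⟨ζ, hmem⟩ : K)]
    exact minpoly.degree_dvd (IsIntegral.of_finite ℚ _)
  obtain ⟨j, -, hj⟩ := (Nat.dvd_prime_pow Nat.prime_two).1 hd
  exact ⟨j, hj⟩

/-! ### Roots of unity in fields closed under square roots -/

theorem exists_sq_mem_range_of_finrank_eq_two {k E : Type*} [Field k] [Field E] [Algebra k E]
    (h2 : (2 : k) ≠ 0) (h : Module.finrank k E = 2) :
    ∃ a : E, a ∉ (algebraMap k E).range ∧ a ^ 2 ∈ (algebraMap k E).range := by
  have : FiniteDimensional k E := FiniteDimensional.of_finrank_pos (by lia)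
  obtain ⟨b, hb⟩ : ∃ b : E, b ∉ (algebraMap k E).range := by
    by_contra! hall
    have := Algebra.finrank_eq_of_equiv_equiv (RingEquiv.refl k)
      (RingEquiv.ofBijective (algebraMap k E) ⟨(algebraMap k E).injective, hall⟩) (by ext; rfl)
    rw [Module.finrank_self, h] at this
    lia
  have hint : IsIntegral k b := IsIntegral.of_finite k b
  have hdeg : (minpoly k b).natDegree = 2 := by
    have hd : (minpoly k b).natDegree ∣ 2 := h ▸ minpoly.degree_dvd hint
    refine ((Nat.dvd_prime Nat.prime_two).1 hd).resolve_left fun h1 ↦ hb ?_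
    exact minpoly.natDegree_eq_one_iff.1 h1
  have hroot := minpoly.aeval k b
  have hlead : (minpoly k b).coeff 2 = 1 := hdeg ▸ minpoly.monic hint
  rw [Polynomial.aeval_eq_sum_range, hdeg, Finset.sum_range_succ, Finset.sum_range_succ,
    Finset.sum_range_one, hlead] at hroot
  simp only [Algebra.smul_def, pow_zero, pow_one, mul_one, map_one, one_mul] at hroot
  set c₀ := (minpoly k b).coeff 0
  set c₁ := (minpoly k b).coeff 1
  -- Completing the square in b² + c₁b + c₀ = 0.
  refine ⟨b + algebraMap k E (c₁ / 2), fun hmem ↦ hb ?_, ⟨c₁ ^ 2 / 4 - c₀, ?_⟩⟩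
  · simpa using sub_mem hmem (⟨c₁ / 2, rfl⟩ : algebraMap k E (c₁ / 2) ∈ (algebraMap k E).range)
  · have h2' : algebraMap k E 2 = 2 := map_ofNat _ 2
    have h2E : (2 : E) ≠ 0 := by
      rw [← h2']
      simpa using h2
    have h4 : (4 : E) ≠ 0 := by
      rw [show (4 : E) = 2 * 2 by norm_num]
      exact mul_ne_zero h2E h2E
    have h4' : algebraMap k E 4 = 4 := map_ofNat _ 4
    simp only [map_sub, map_div₀, map_pow, h2', h4']
    field_simp
    linear_combination (-16 : E) * hroot

open IntermediateField in
theorem IsPrimitiveRoot.mem_subfield_of_totient_eq_two_pow {F : Subfield ℂ}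
    (hF : ∀ z : ℂ, z ^ 2 ∈ F → z ∈ F) {n j : ℕ} [NeZero n] (h : n.totient = 2 ^ j) {ζ : ℂ}
    (hζ : IsPrimitiveRoot ζ n) : ζ ∈ F := by
  have hint : IsIntegral F ζ := (hζ.isIntegral (NeZero.pos n)).tower_top
  have hζ' : IsPrimitiveRoot (AdjoinSimple.gen F ζ) n :=
    IsPrimitiveRoot.of_map_of_injective (f := algebraMap F⟮ζ⟯ ℂ) (by simpa using hζ)
      (algebraMap F⟮ζ⟯ ℂ).injective
  have hcyc : IsCyclotomicExtension {n} F F⟮ζ⟯ := by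
    change IsCyclotomicExtension {n} F F⟮ζ⟯.toSubalgebra
    rw [adjoin_simple_toSubalgebra_of_isAlgebraic hint.isAlgebraic]
    exact hζ.adjoin_isCyclotomicExtension F
  have hfin : FiniteDimensional F F⟮ζ⟯ := adjoin.finiteDimensional hint
  have hgal : IsGalois F F⟮ζ⟯ := IsCyclotomicExtension.isGalois {n} F F⟮ζ⟯
  have hcard : Nat.card Gal(F⟮ζ⟯/F) ∣ 2 ^ j := by
    rw [← h, ← ZMod.card_units_eq_totient, ← Nat.card_eq_fintype_card]
    exact Subgroup.card_dvd_of_injective _ (hζ'.autToPow_injective F)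
  obtain ⟨i, -, hi⟩ := (Nat.dvd_prime_pow Nat.prime_two).1 hcard
  have hrank : Module.finrank F F⟮ζ⟯ = 2 ^ i := by rw [← hi, IsGalois.card_aut_eq_finrank]
  rcases i with _ | i
  · obtain ⟨x, hx⟩ := mem_bot.1 (finrank_adjoin_simple_eq_one_iff.1 hrank)
    exact hx ▸ x.2
  -- A subgroup of order 2^i has index 2, so its fixed field is quadratic over F and contains some a
  -- ∉ F with a² ∈ F, contrary to `hF`.
  · exfalso
    obtain ⟨H, hH⟩ := Sylow.exists_subgroup_card_pow_prime (G := Gal(F⟮ζ⟯/F)) 2 (n := i)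
      (hi ▸ pow_dvd_pow 2 i.le_succ)
    have hmul := Module.finrank_mul_finrank F (fixedField H) F⟮ζ⟯
    rw [finrank_fixedField_eq_card, hH, hrank, pow_succ'] at hmul
    obtain ⟨a, ha, b, hb⟩ := exists_sq_mem_range_of_finrank_eq_two (two_ne_zero)
      (Nat.eq_of_mul_eq_mul_right (by positivity) hmul)
    have hsq : ((a : F⟮ζ⟯) : ℂ) ^ 2 = b :=
      (congrArg (fun x : fixedField H ↦ ((x : F⟮ζ⟯) : ℂ)) hb).symm
    refine ha ⟨⟨_, hF ((a : F⟮ζ⟯) : ℂ) (hsq ▸ b.2)⟩, ?_⟩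
    ext
    rfl

/-! ### Regular polygons and roots of unity -/

open Complex in
theorem exp_mul_I_mem_constructibleField {t : ℝ} :
    exp (t * I) ∈ constructibleField ↔ ConstructiblePoint !₂[Real.cos t, Real.sin t] := by
  rw [mem_constructibleField, exp_ofReal_mul_I_re, exp_ofReal_mul_I_im]
  exact ⟨fun h ↦ h.1.mk h.2, ConstructibleReal.of_point⟩

theorem regularPolygonConstructible_of_totient_eq_two_pow {n j : ℕ} (hn : n ≠ 0)
    (h : n.totient = 2 ^ j) : RegularPolygonConstructible n := by
  have : NeZero n := ⟨hn⟩
  have hmem := (Complex.isPrimitiveRoot_exp n hn).mem_subfield_of_totient_eq_two_pow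
    (fun z ↦ mem_constructibleField_of_sq_mem) h
  refine ⟨⟨fun i ↦ !₂[Real.cos (2 * Real.pi * (i : ℕ) / n), Real.sin (2 * Real.pi * (i : ℕ) / n)]⟩,
    ⟨0, 1, 0, one_pos, fun i ↦ by simp⟩, fun i ↦ ?_⟩
  rw [← exp_mul_I_mem_constructibleField]
  convert pow_mem hmem (i : ℕ) using 1
  rw [← Complex.exp_nat_mul]
  congr 1
  push_cast
  ring

/-- Centre, radius and direction cancel in the ratio of two successive sides, so nothing about them
has to be known. -/
theorem Polygon.IsRegular.exp_eq_div {n : ℕ} {poly : Polygon Plane n} (h : poly.IsRegular)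
    (hn : 3 ≤ n) {z : Fin n → ℂ} (hz : ∀ i, z i = (poly i 0 : ℂ) + (poly i 1 : ℂ) * Complex.I) :
    Complex.exp (2 * Real.pi * Complex.I / n)
      = (z ⟨2, by lia⟩ - z ⟨1, by lia⟩) / (z ⟨1, by lia⟩ - z ⟨0, by lia⟩) := by
  obtain ⟨O, r, θ, hr, hp⟩ := h
  set ζ := Complex.exp (2 * Real.pi * Complex.I / n) with hζ
  have hζ1 : ζ ≠ 1 := (Complex.isPrimitiveRoot_exp n (by lia)).ne_one (by lia)
  have hz' (i : Fin n) : z i = (O 0 + O 1 * Complex.I) +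
      r * Complex.exp (θ * Complex.I) * ζ ^ (i : ℕ) := by
    rw [hz, hp, hζ, ← Complex.exp_nat_mul, mul_assoc (r : ℂ), ← Complex.exp_add,
      show (θ : ℂ) * Complex.I + (i : ℕ) * (2 * Real.pi * Complex.I / n)
        = ((θ + 2 * Real.pi * (i : ℕ) / n : ℝ) : ℂ) * Complex.I by push_cast; ring,
      Complex.exp_mul_I, ← Complex.ofReal_cos, ← Complex.ofReal_sin]
    simp only [PiLp.add_apply, PiLp.smul_apply, smul_eq_mul, Matrix.cons_val_zero,
      Matrix.cons_val_one]
    push_cast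
    ring
  have hr' : (r : ℂ) ≠ 0 := by exact_mod_cast hr.ne'
  have he := Complex.exp_ne_zero (θ * Complex.I)
  have hd : z ⟨1, by lia⟩ - z ⟨0, by lia⟩ = r * Complex.exp (θ * Complex.I) * (ζ - 1) := by
    rw [hz', hz']
    ring
  rw [eq_div_iff (by rw [hd]; exact mul_ne_zero (mul_ne_zero hr' he) (sub_ne_zero.2 hζ1)), hd, hz',
    hz']
  ring

theorem totient_eq_two_pow_of_regularPolygonConstructible {n : ℕ} (hn : 3 ≤ n)
    (h : RegularPolygonConstructible n) : ∃ j, n.totient = 2 ^ j := by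
  obtain ⟨poly, hreg, hpoly⟩ := h
  -- The real numbers in `quadraticClosure` form the field to which `ConstructiblePoint.coord_mem`
  -- is applied.
  have hF (x : ℝ) (hx : x ^ 2 ∈ quadraticClosure.comap Complex.ofRealHom) :
      x ∈ quadraticClosure.comap Complex.ofRealHom := by
    refine mem_quadraticClosure_of_sq_mem ?_
    rw [← map_pow]
    exact hx
  have hI : Complex.I ∈ quadraticClosure :=
    mem_quadraticClosure_of_sq_mem (by rw [Complex.I_sq]; exact neg_mem (one_mem _))
  have hz (i : Fin n) : (poly i 0 : ℂ) + (poly i 1 : ℂ) * Complex.I ∈ quadraticClosure :=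
    add_mem ((hpoly i).coord_mem hF).1 (mul_mem ((hpoly i).coord_mem hF).2 hI)
  refine exists_totient_eq_two_pow_of_mem_quadraticClosure (by lia)
    (Complex.isPrimitiveRoot_exp n (by lia)) ?_
  rw [hreg.exp_eq_div hn fun _ ↦ rfl]
  exact div_mem (sub_mem (hz _) (hz _)) (sub_mem (hz _) (hz _))

theorem theorem6 (n : ℕ) (hn : 3 ≤ n) :
    RegularPolygonConstructible n ↔
      ∃ (k : ℕ) (S : Finset ℕ),
        (∀ p ∈ S, p.Prime ∧ ∃ r : ℕ, p = 2 ^ (2 ^ r) + 1) ∧ n = 2 ^ k * ∏ p ∈ S, p := by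
  rw [← Nat.exists_totient_eq_two_pow_iff (by lia)]
  exact ⟨totient_eq_two_pow_of_regularPolygonConstructible hn,
    fun ⟨_, hj⟩ ↦ regularPolygonConstructible_of_totient_eq_two_pow (by lia) hj⟩
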